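/- Let $X$ be a CAT(0) space (not assumed proper or complete). For a geodesic $b:I\to X$ (an isometric embedding of a closed, possibly unbounded interval $I\subseteq\mathbb{R}$) with closest point projection $\pi_b$, and a number $r$ such that $[r-\tfrac12,r+\tfrac12]$ lies in the interior of $I$, the set $h=\pi_b^{-1}\big(b[r-\tfrac12,r+\tfrac12]\big)$ is called a \emph{curtain}, with half spaces $h^-=\pi_b^{-1}\big(b(I\cap(-\infty,r-\tfrac12))\big)$ and $h^+=\pi_b^{-1}\big(b(I\cap(r+\tfrac12,\infty))\big)$. A curtain \emph{separates} two sets if one of them lies in one of its half spaces and the other one lies in the other. Two curtains \emph{cross} if they have nonempty intersection. A \emph{chain} is a finite sequence $h_1,\dots,h_n$ of pairwise disjoint curtains such that $h_i$ separates $h_{i-1}$ from $h_{i+1}$ for all $1<i<n$. A \emph{curtain grid} is a pair of chains $\mathcal{H}=\{h_1,\dots,h_n\}$, $\mathcal{K}=\{k_1,\dots,k_m\}$ such that every curtain of $\mathcal{H}$ crosses every curtain of $\mathcal{K}$; for $E>0$ it is \emph{$E$-thin} if $\min\{|\mathcal{H}|,|\mathcal{K}|\}\le E$. Theorem E. $X$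 is Gromov hyperbolic (that is, for some $\delta\ge 0$ every side of every geodesic triangle in $X$ lies in the closed $\delta$-neighbourhood of the union of the other two sides) if and only if there is $E>0$ such that every curtain grid in $X$ is $E$-thin. -/

import Mathlib

namespace CurtainGrid

/-- `b` restricted to `I` is a (unit speed) geodesic: an isometric embedding of `I`. -/
def IsGeodesicOn {X : Type*} [MetricSpace X] (b : ℝ → X) (I : Set ℝ) : Prop :=
  ∀ s ∈ I, ∀ t ∈ I, dist (b s) (b t) = |s - t|

/-- `S` is (the image of) a geodesic segment `[x, y]` from `x` to `y`. -/
def IsGeodesicSegment {X : Type*} [MetricSpace X] (S : Set X) (x y : X) : Prop :=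
  ∃ γ : ℝ → X, IsGeodesicOn γ (Set.Icc 0 (dist x y)) ∧ γ 0 = x ∧ γ (dist x y) = y ∧
    S = γ '' Set.Icc 0 (dist x y)

/-- CAT(0) space: a geodesic metric space in which distances between points `p`, `q` of two sides
of a geodesic triangle are at most the distances between the corresponding points of the
comparison triangle in the Euclidean plane.  (For two points of the same side equality is
automatic; the triangle may be relabelled, so it is enough to name the common vertex `x`.) -/
structure IsCAT0 (X : Type*) [MetricSpace X] : Prop where
  exists_segment : ∀ x y : X, ∃ S : Set X, IsGeodesicSegment S x y
  comparison : ∀ (x y z : X) (Sxy Sxz Syz : Set X),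
    IsGeodesicSegment Sxy x y → IsGeodesicSegment Sxz x z → IsGeodesicSegment Syz y z →
    ∀ x' y' z' : EuclideanSpace ℝ (Fin 2),
      dist x' y' = dist x y → dist x' z' = dist x z → dist y' z' = dist y z →
    ∀ p ∈ Sxy, ∀ q ∈ Sxz, ∀ p' q' : EuclideanSpace ℝ (Fin 2),
      dist x' p' = dist x p → dist p' y' = dist p y →
      dist x' q' = dist x q → dist q' z' = dist q z →
      dist p q ≤ dist p' q'

/-- Gromov hyperbolicity of a geodesic space: all geodesic triangles are `δ`-slim,
for one constant `δ`. -/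
def IsGromovHyperbolic (X : Type*) [MetricSpace X] : Prop :=
  ∃ δ : ℝ, 0 ≤ δ ∧ ∀ (x y z : X) (Sxy Syz Sxz : Set X),
    IsGeodesicSegment Sxy x y → IsGeodesicSegment Syz y z → IsGeodesicSegment Sxz x z →
    ∀ p ∈ Sxy, ∃ q ∈ Syz ∪ Sxz, dist p q ≤ δ

/-- `b t` is a closest point to `x` on the geodesic `b : I → X`.  In a CAT(0) space, for `I` a
nonempty closed interval, there is exactly one such `t`, and `b t` is the closest point
projection of `x` to `b`. -/
def ProjectsTo {X : Type*} [MetricSpace X] (b : ℝ → X) (I : Set ℝ) (x : X) (t : ℝ) : Prop :=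
  t ∈ I ∧ ∀ s ∈ I, dist x (b t) ≤ dist x (b s)

/-- The data of a curtain: a geodesic `b : I → X` on a closed (possibly unbounded) interval `I`
and a number `r` with `[r - 1/2, r + 1/2]` contained in the interior of `I`. -/
structure Curtain (X : Type*) [MetricSpace X] where
  b : ℝ → X
  I : Set ℝ
  r : ℝ
  isClosed_I : IsClosed I
  ordConnected_I : I.OrdConnected
  isGeodesicOn : IsGeodesicOn b I
  pole_subset : Set.Icc (r - 1 / 2) (r + 1 / 2) ⊆ interior I

namespace Curtain

variable {X : Type*} [MetricSpace X]

/-- The curtain as a subset of `X`: the points whose projection to `b` lies in the pole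
`b [r - 1/2, r + 1/2]`. -/
def carrier (h : Curtain X) : Set X :=
  {x | ∃ t ∈ Set.Icc (h.r - 1 / 2) (h.r + 1 / 2), ProjectsTo h.b h.I x t}

/-- The half space `h⁻`: the points that project to `b` before the pole. -/
def neg (h : Curtain X) : Set X :=
  {x | ∃ t, t < h.r - 1 / 2 ∧ ProjectsTo h.b h.I x t}

/-- The half space `h⁺`: the points that project to `b` after the pole. -/
def pos (h : Curtain X) : Set X :=
  {x | ∃ t, h.r + 1 / 2 < t ∧ ProjectsTo h.b h.I x t}

/-- `h` separates `A` and `B`: they lie in different half spaces of `h`.  (Which half space is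
called `h⁻` only depends on the direction in which `b` is traversed.) -/
def Separates (h : Curtain X) (A B : Set X) : Prop :=
  (A ⊆ h.neg ∧ B ⊆ h.pos) ∨ (A ⊆ h.pos ∧ B ⊆ h.neg)

/-- Two curtains cross if they meet. -/
def Crosses (h k : Curtain X) : Prop :=
  (h.carrier ∩ k.carrier).Nonempty

end Curtain

/-- The curtains `h 0, …, h (n - 1)` form a chain: they are pairwise disjoint, and each one
separates its predecessor from its successor.  Being disjoint and nonempty they are distinct,
so that the chain has cardinality `n`. -/
def IsChain {X : Type*} [MetricSpace X] {n : ℕ} (h : Fin n → Curtain X) : Prop :=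
  (∀ i j, i ≠ j → Disjoint (h i).carrier (h j).carrier) ∧
  ∀ i j k : Fin n, (i : ℕ) + 1 = j → (j : ℕ) + 1 = k →
    (h j).Separates (h i).carrier (h k).carrier

/-- Two chains form a curtain grid if every curtain of one crosses every curtain of the other. -/
def IsCurtainGrid {X : Type*} [MetricSpace X] {n m : ℕ}
    (H : Fin n → Curtain X) (K : Fin m → Curtain X) : Prop :=
  IsChain H ∧ IsChain K ∧ ∀ i j, (H i).Crosses (K j)

/-- Every curtain grid of `X` is `E`-thin: the shorter of its two chains has at most `E`
curtains. -/
def AllGridsThin (X : Type*) [MetricSpace X] (E : ℝ) : Prop :=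
  ∀ (n m : ℕ) (H : Fin n → Curtain X) (K : Fin m → Curtain X),
    IsCurtainGrid H K → min (n : ℝ) (m : ℝ) ≤ E

end CurtainGrid

/-!
Along a geodesic of a CAT(0) space the squared distance to a point is `2`-strongly convex. Hence
closest point projections to geodesics are `1`-Lipschitz, and the fibres of a projection are
star-shaped about their feet, so that curtains and half spaces are well behaved.

If some `N × N` grid does not exist, let `c` be the perpendicular from a point `p` to a geodesic
`b`. Were `c` long, and were `p` on a geodesic `[x, y]` whose ends both project far from `p` on `b`,
then `x` or `y` would project to `p` on `c`, and the curtains dual to `b` would cross those dual to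
`c`. So geodesics fellow-travel with every geodesic along which they make progress, and triangles
are slim.

Conversely, slimness makes curtains uniformly quasiconvex. In a grid, the four corners where the
extreme curtains meet span a quadrilateral with quasiconvex sides; slimness forces two opposite
sides close together, whereas the first and last curtains of a chain of length `n` have distance at
least `n - 2`.
-/

namespace CurtainGrid

open Set Metric

/-! ### Convexity and comparison triangles -/

section Prerequisites

variable {X E : Type*} [PseudoMetricSpace X] [NormedAddCommGroup E] [NormedSpace ℝ E]

lemma add_le_of_isMinOn_of_uniformConvexOn {s : Set E} {φ : ℝ → ℝ} {f : E → ℝ} {x y : E}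
    (hf : UniformConvexOn s φ f) (hmin : IsMinOn f s x) (hx : x ∈ s) (hy : y ∈ s) :
    f x + φ ‖x - y‖ ≤ f y := by
  have hlim : Filter.Tendsto (fun ε : ℝ => f x + (1 - ε) * φ ‖x - y‖) (nhdsWithin 0 (Ioi 0))
      (nhds (f x + φ ‖x - y‖)) := by
    have hcont : Continuous fun ε : ℝ => f x + (1 - ε) * φ ‖x - y‖ := by fun_prop
    simpa only [sub_zero, one_mul] using (hcont.tendsto 0).mono_left nhdsWithin_le_nhds
  refine le_of_tendsto hlim ?_
  filter_upwards [Ioo_mem_nhdsGT (zero_lt_one' ℝ)] with ε hε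
  have hε' : 0 ≤ 1 - ε := sub_nonneg.2 hε.2.le
  have hle : f x ≤ f ((1 - ε) • x + ε • y) :=
    hmin (hf.1 hx hy hε' hε.1.le (sub_add_cancel 1 ε))
  have hconv := hf.2 hx hy hε' hε.1.le (sub_add_cancel 1 ε)
  simp only [smul_eq_mul] at hconv
  exact le_of_mul_le_mul_left (by linarith) hε.1

lemma strongConvexOn_sq_norm {F : Type*} [NormedAddCommGroup F] [InnerProductSpace ℝ F] :
    StrongConvexOn univ 2 fun x : F => ‖x‖ ^ 2 := by
  rw [strongConvexOn_iff_convex]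
  simpa using convexOn_const (0 : ℝ) (convex_univ (𝕜 := ℝ) (E := F))

lemma exists_comparison_triangle (hE : 1 < Module.rank ℝ E) (x y z : X) :
    ∃ x' y' z' : E, dist x' y' = dist x y ∧ dist x' z' = dist x z ∧ dist y' z' = dist y z := by
  have : Nontrivial E := rank_pos_iff_nontrivial.1 (zero_lt_one.trans hE)
  obtain ⟨e, he⟩ := exists_norm_eq E zero_le_one
  set c := dist x y
  set r := dist x z
  have hr : 0 ≤ r := dist_nonneg
  have hmem : ∀ ε : ℝ, |ε| = 1 → (ε * r) • e ∈ sphere (0 : E) r := fun ε hε => by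
    simp [norm_smul, he, hε, abs_of_nonneg hr]
  have hdist : ∀ ε : ℝ, dist (c • e) ((ε * r) • e) = |c - ε * r| := fun ε => by
    rw [dist_eq_norm, ← sub_smul, norm_smul, he, mul_one, Real.norm_eq_abs]
  obtain ⟨z', hz', hyz⟩ := (isPreconnected_sphere hE (0 : E) r).intermediate_value
    (hmem 1 (by simp)) (hmem (-1) (by simp)) (f := fun w => dist (c • e) w) (by fun_prop)
    (show dist y z ∈ Icc _ _ by
      rw [hdist, hdist, mem_Icc, abs_le, le_abs]
      refine ⟨⟨?_, ?_⟩, Or.inl ?_⟩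
      · linarith [dist_triangle x y z]
      · linarith [dist_triangle_right x y z]
      · linarith [dist_triangle_left y z x])
  refine ⟨0, c • e, z', ?_, ?_, hyz⟩
  · rw [dist_zero_left, norm_smul, he, mul_one, Real.norm_of_nonneg dist_nonneg]
  · rwa [dist_comm]

lemma exists_dist_lt_two_mul_of_subset_thickening_union {S A B : Set X} {ε : ℝ}
    (hS : IsPreconnected S) (hcover : S ⊆ thickening ε A ∪ thickening ε B)
    (hA : (S ∩ thickening ε A).Nonempty) (hB : (S ∩ thickening ε B).Nonempty) :
    ∃ a ∈ A, ∃ b ∈ B, dist a b < 2 * ε := by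
  obtain ⟨p, -, hpA, hpB⟩ := hS _ _ isOpen_thickening isOpen_thickening hcover hA hB
  obtain ⟨a, ha, hpa⟩ := mem_thickening_iff.1 hpA
  obtain ⟨b, hb, hpb⟩ := mem_thickening_iff.1 hpB
  exact ⟨a, ha, b, hb, by linarith [dist_triangle_left a b p]⟩

end Prerequisites

variable {X : Type*} [MetricSpace X]

/-! ### Geodesics -/

/-- A geodesic space: any two points are joined by a geodesic segment. -/
def IsGeodesicSpace (X : Type*) [MetricSpace X] : Prop :=
  ∀ x y : X, ∃ S : Set X, IsGeodesicSegment S x y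

namespace IsGeodesicOn

variable {b : ℝ → X} {I J : Set ℝ} {s t u v : ℝ}

lemma mono (hb : IsGeodesicOn b I) (hJ : J ⊆ I) : IsGeodesicOn b J :=
  fun s hs t ht => hb s (hJ hs) t (hJ ht)

lemma continuousOn (hb : IsGeodesicOn b I) : ContinuousOn b I := by
  have : LipschitzOnWith 1 b I := LipschitzOnWith.of_dist_le_mul fun s hs t ht => by
    rw [hb s hs t ht, NNReal.coe_one, one_mul, Real.dist_eq]
  exact this.continuousOn

lemma dist_of_le (hb : IsGeodesicOn b I) (hs : s ∈ I) (ht : t ∈ I) (hst : s ≤ t) :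
    dist (b s) (b t) = t - s := by
  rw [hb s hs t ht, abs_sub_comm, abs_of_nonneg (sub_nonneg.2 hst)]

lemma isGeodesicSegment_image (hb : IsGeodesicOn b (Icc u v)) (huv : u ≤ v) :
    IsGeodesicSegment (b '' Icc u v) (b u) (b v) := by
  have hdist : dist (b u) (b v) = v - u :=
    hb.dist_of_le (left_mem_Icc.2 huv) (right_mem_Icc.2 huv) huv
  have himage : (fun t => u + t) '' Icc 0 (v - u) = Icc u v := by
    rw [image_const_add_Icc, add_zero, add_sub_cancel]
  refine ⟨fun t => b (u + t), ?_, by simp, by simp [hdist], ?_⟩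
  · rw [hdist]
    intro s hs t ht
    rw [hb _ (himage ▸ mem_image_of_mem _ hs) _ (himage ▸ mem_image_of_mem _ ht),
      add_sub_add_left_eq_sub]
  · rw [hdist, ← himage, image_image]

end IsGeodesicOn

namespace IsGeodesicSegment

variable {S : Set X} {x y : X}

lemma left_mem (hS : IsGeodesicSegment S x y) : x ∈ S := by
  obtain ⟨γ, -, h0, -, rfl⟩ := hS
  exact ⟨0, left_mem_Icc.2 dist_nonneg, h0⟩

lemma right_mem (hS : IsGeodesicSegment S x y) : y ∈ S := by
  obtain ⟨γ, -, -, h1, rfl⟩ := hS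
  exact ⟨dist x y, right_mem_Icc.2 dist_nonneg, h1⟩

lemma isPreconnected (hS : IsGeodesicSegment S x y) : IsPreconnected S := by
  obtain ⟨γ, hγ, -, -, rfl⟩ := hS
  exact isPreconnected_Icc.image _ hγ.continuousOn

lemma dist_add_dist (hS : IsGeodesicSegment S x y) {w : X} (hw : w ∈ S) :
    dist x w + dist w y = dist x y := by
  obtain ⟨γ, hγ, h0, h1, rfl⟩ := hS
  obtain ⟨t, ht, rfl⟩ := hw
  have hleft := hγ.dist_of_le (left_mem_Icc.2 dist_nonneg) ht ht.1
  have hright := hγ.dist_of_le ht (right_mem_Icc.2 dist_nonneg) ht.2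
  rw [h0] at hleft
  rw [h1] at hright
  linarith

lemma symm (hS : IsGeodesicSegment S x y) : IsGeodesicSegment S y x := by
  obtain ⟨γ, hγ, h0, h1, rfl⟩ := hS
  have himage : (fun t => dist x y - t) '' Icc 0 (dist x y) = Icc 0 (dist x y) := by
    rw [image_const_sub_Icc, sub_self, sub_zero]
  rw [IsGeodesicSegment, dist_comm y x]
  refine ⟨fun t => γ (dist x y - t), fun s hs t ht => ?_, by simpa using h1, by simpa using h0, ?_⟩
  · rw [hγ _ (himage ▸ mem_image_of_mem _ hs) _ (himage ▸ mem_image_of_mem _ ht),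
      sub_sub_sub_cancel_left, abs_sub_comm]
  · nth_rw 1 [← himage]
    rw [image_image]

lemma exists_apply_eq (hS : IsGeodesicSegment S x y) {f : X → ℝ} (hf : Continuous f) {r : ℝ}
    (hr : r ∈ uIcc (f x) (f y)) : ∃ w ∈ S, f w = r :=
  (hS.isPreconnected.image f hf.continuousOn).ordConnected.uIcc_subset
    (mem_image_of_mem f hS.left_mem) (mem_image_of_mem f hS.right_mem) hr

end IsGeodesicSegment

/-! ### Comparison inequalities in CAT(0) spaces -/

namespace IsCAT0

variable (hX : IsCAT0 X)
include hX

lemma isGeodesicSpace : IsGeodesicSpace X := hX.exists_segment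

lemma sq_dist_le_of_mem_segment {S : Set X} {x y p : X} {α β : ℝ} (hS : IsGeodesicSegment S x y)
    (hp : p ∈ S) (hα : 0 ≤ α) (hβ : 0 ≤ β) (hαβ : α + β = 1) (hxp : dist x p = β * dist x y)
    (z : X) :
    dist z p ^ 2 ≤ α * dist z x ^ 2 + β * dist z y ^ 2 - α * β * dist x y ^ 2 := by
  obtain ⟨Sxz, hxz⟩ := hX.exists_segment x z
  obtain ⟨Syz, hyz⟩ := hX.exists_segment y z
  obtain ⟨x', y', z', hxy', hxz', hyz'⟩ :=
    exists_comparison_triangle (E := EuclideanSpace ℝ (Fin 2))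
      (by simp [← Module.finrank_eq_rank]) x y z
  set p' := AffineMap.lineMap x' y' β
  have hpy : dist p y = α * dist x y := by
    have := hS.dist_add_dist hp
    rw [hxp] at this
    linear_combination this - dist x y * hαβ
  have hcomparison : dist p z ≤ dist p' z' := by
    refine hX.comparison x y z S Sxz Syz hS hxz hyz x' y' z' hxy' hxz' hyz' p hp z
      hxz.right_mem p' z' ?_ ?_ hxz' (by simp)
    · rw [dist_left_lineMap, hxy', hxp, Real.norm_of_nonneg hβ]
    · rw [dist_lineMap_right, hxy', hpy, ← hαβ, add_sub_cancel_right, Real.norm_of_nonneg hα]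
  have hp' : p' - z' = α • (x' - z') + β • (y' - z') := by
    rw [← eq_sub_iff_add_eq] at hαβ
    simp only [p', AffineMap.lineMap_apply_module, hαβ]
    module
  have heuclidean := strongConvexOn_sq_norm.2 (mem_univ (x' - z')) (mem_univ (y' - z')) hα hβ hαβ
  simp only [← hp', sub_sub_sub_cancel_right, ← dist_eq_norm, hxy', hxz', hyz', smul_eq_mul,
    div_self (two_ne_zero' ℝ), one_mul] at heuclidean
  rw [dist_comm z p, dist_comm z x, dist_comm z y]
  exact (pow_le_pow_left₀ dist_nonneg hcomparison 2).trans heuclidean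

lemma strongConvexOn_sq_dist {b : ℝ → X} {I : Set ℝ} (hI : I.OrdConnected)
    (hb : IsGeodesicOn b I) (z : X) : StrongConvexOn I 2 fun t => dist z (b t) ^ 2 := by
  refine ⟨hI.convex, fun u hu v hv α β hα hβ hαβ => ?_⟩
  wlog huv : u ≤ v generalizing u v α β
  · have := this v hv u hu β α hβ hα (by rwa [add_comm]) (le_of_not_ge huv)
    rwa [add_comm (β • v), add_comm (β • _), norm_sub_rev, mul_comm β] at this
  have hsub := hI.out hu hv
  have hmem : α • u + β • v ∈ Icc u v :=
    convex_Icc u v (left_mem_Icc.2 huv) (right_mem_Icc.2 huv) hα hβ hαβ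
  have hdist := hb.dist_of_le hu hv huv
  have hfrac : dist (b u) (b (α • u + β • v)) = β * dist (b u) (b v) := by
    rw [hb.dist_of_le hu (hsub hmem) hmem.1, hdist]
    simp only [smul_eq_mul]
    linear_combination u * hαβ
  have hle := hX.sq_dist_le_of_mem_segment ((hb.mono hsub).isGeodesicSegment_image huv)
    (mem_image_of_mem b hmem) hα hβ hαβ hfrac z
  rwa [hb u hu v hv, ← Real.norm_eq_abs, ← one_mul (‖u - v‖ ^ 2), ← div_self two_ne_zero] at hle

lemma sq_dist_add_sq_dist_le (p q r s : X) :
    dist p r ^ 2 + dist q s ^ 2 ≤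
      dist p q ^ 2 + dist q r ^ 2 + dist r s ^ 2 + dist s p ^ 2 := by
  obtain ⟨S, hS⟩ := hX.exists_segment q s
  obtain ⟨m, hm, hqm⟩ := hS.exists_apply_eq (f := dist q) (by fun_prop) (r := 1 / 2 * dist q s) (by
    rw [dist_self, uIcc_of_le dist_nonneg]
    constructor <;> linarith [dist_nonneg (x := q) (y := s)])
  have hmedian := hX.sq_dist_le_of_mem_segment hS hm (by norm_num) (by norm_num)
    (add_halves (1 : ℝ)) hqm
  have hpr : dist p r ^ 2 ≤ 2 * (dist p m ^ 2 + dist r m ^ 2) :=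
    (pow_le_pow_left₀ dist_nonneg (dist_triangle_right p r m) 2).trans add_sq_le
  rw [dist_comm q r, dist_comm s p]
  linarith [hmedian p, hmedian r]

end IsCAT0

/-! ### Closest point projections -/

/-- The data to which closest points are projected: a geodesic on a nonempty closed interval. -/
structure IsClosedGeodesic (b : ℝ → X) (I : Set ℝ) : Prop where
  isClosed : IsClosed I
  ordConnected : I.OrdConnected
  nonempty : I.Nonempty
  isGeodesicOn : IsGeodesicOn b I

/-- The closest point projection `π_b`, as the parameter in `I` of the closest point to `x` on
`b`. It is an arbitrary number if there is no closest point. -/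
noncomputable def proj (b : ℝ → X) (I : Set ℝ) (x : X) : ℝ :=
  Classical.epsilon (ProjectsTo b I x)

lemma IsGeodesicOn.isClosedGeodesic_Icc {b : ℝ → X} {u v : ℝ} (hb : IsGeodesicOn b (Icc u v))
    (huv : u ≤ v) : IsClosedGeodesic b (Icc u v) :=
  ⟨isClosed_Icc, ordConnected_Icc, nonempty_Icc.2 huv, hb⟩

lemma projectsTo_self {b : ℝ → X} {I : Set ℝ} {t : ℝ} (ht : t ∈ I) : ProjectsTo b I (b t) t :=
  ⟨ht, fun s _ => by rw [dist_self]; exact dist_nonneg⟩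

lemma ProjectsTo.of_mem_segment {b : ℝ → X} {I : Set ℝ} {S : Set X} {x y : X} {t : ℝ}
    (hx : ProjectsTo b I x t) (hS : IsGeodesicSegment S x (b t)) (hy : y ∈ S) :
    ProjectsTo b I y t :=
  ⟨hx.1, fun s hs => by linarith [hx.2 s hs, dist_triangle x y (b s), hS.dist_add_dist hy]⟩

lemma IsClosedGeodesic.projectsTo_proj {b : ℝ → X} {I : Set ℝ} (hb : IsClosedGeodesic b I)
    (x : X) : ProjectsTo b I x (proj b I x) := by
  obtain ⟨t₀, ht₀⟩ := hb.nonempty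
  have hfar : ∀ᶠ t in Filter.cocompact ℝ ⊓ Filter.principal I, dist x (b t₀) ≤ dist x (b t) := by
    rw [Filter.eventually_inf_principal]
    filter_upwards [(tendsto_dist_left_cocompact_atTop t₀).eventually_ge_atTop
      (2 * dist x (b t₀))] with t ht htI
    rw [Real.dist_eq, ← hb.isGeodesicOn t₀ ht₀ t htI] at ht
    linarith [dist_triangle_left (b t₀) (b t) x]
  have hcont : ContinuousOn (fun t => dist x (b t)) I :=
    (continuous_const.dist continuous_id).comp_continuousOn hb.isGeodesicOn.continuousOn
  obtain ⟨t, ht, hmin⟩ := hcont.exists_isMinOn' hb.isClosed ht₀ hfar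
  exact Classical.epsilon_spec (p := ProjectsTo b I x) ⟨t, ht, fun s hs => hmin hs⟩

namespace IsCAT0

variable (hX : IsCAT0 X) {b c : ℝ → X} {I J : Set ℝ} {L s t : ℝ} {x y : X}
include hX

lemma sq_dist_add_sq_le (hI : I.OrdConnected) (hb : IsGeodesicOn b I) (ht : ProjectsTo b I x t)
    (hs : s ∈ I) : dist x (b t) ^ 2 + (t - s) ^ 2 ≤ dist x (b s) ^ 2 := by
  have hmin : IsMinOn (fun r => dist x (b r) ^ 2) I t :=
    fun r hr => pow_le_pow_left₀ dist_nonneg (ht.2 r hr) 2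
  have hle := add_le_of_isMinOn_of_uniformConvexOn (hX.strongConvexOn_sq_dist hI hb x) hmin ht.1 hs
  simpa only [div_self (two_ne_zero' ℝ), one_mul, Real.norm_eq_abs, sq_abs] using hle

lemma abs_sub_le_dist (hI : I.OrdConnected) (hb : IsGeodesicOn b I) (hs : ProjectsTo b I x s)
    (ht : ProjectsTo b I y t) : |s - t| ≤ dist x y := by
  have hx := hX.sq_dist_add_sq_le hI hb hs ht.1
  have hy := hX.sq_dist_add_sq_le hI hb ht hs.1
  have hquad := hX.sq_dist_add_sq_dist_le x y (b t) (b s)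
  rw [hb t ht.1 s hs.1, sq_abs, dist_comm (b s) x] at hquad
  exact abs_le_of_sq_le_sq (by linarith [sub_sq_comm s t]) dist_nonneg

lemma proj_eq (hI : I.OrdConnected) (hb : IsGeodesicOn b I) (ht : ProjectsTo b I x t) :
    proj b I x = t := by
  have hle := hX.abs_sub_le_dist hI hb (Classical.epsilon_spec ⟨t, ht⟩) ht
  rw [dist_self] at hle
  exact sub_eq_zero.1 (abs_nonpos_iff.1 hle)

lemma projectsTo_iff (hb : IsClosedGeodesic b I) : ProjectsTo b I x t ↔ proj b I x = t :=
  ⟨hX.proj_eq hb.ordConnected hb.isGeodesicOn, fun h => h ▸ hb.projectsTo_proj x⟩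

lemma exists_projectsTo_iff (hb : IsClosedGeodesic b I) {p : ℝ → Prop} :
    (∃ t, p t ∧ ProjectsTo b I x t) ↔ p (proj b I x) := by
  simp only [hX.projectsTo_iff hb, exists_eq_right']

lemma lipschitzWith_proj (hb : IsClosedGeodesic b I) : LipschitzWith 1 (proj b I) :=
  LipschitzWith.mk_one fun x y => hX.abs_sub_le_dist hb.ordConnected hb.isGeodesicOn
    (hb.projectsTo_proj x) (hb.projectsTo_proj y)

lemma isPreconnected_preimage_proj (hb : IsClosedGeodesic b I) (hJ : J.OrdConnected) :
    IsPreconnected (proj b I ⁻¹' J) := by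
  refine isPreconnected_of_forall_pair fun x hx y hy => ?_
  have hπx := hb.projectsTo_proj x
  have hπy := hb.projectsTo_proj y
  have hsub : uIcc (proj b I x) (proj b I y) ⊆ I := hb.ordConnected.uIcc_subset hπx.1 hπy.1
  obtain ⟨S, hS⟩ := hX.exists_segment x (b (proj b I x))
  obtain ⟨T, hT⟩ := hX.exists_segment y (b (proj b I y))
  have hpath : IsPreconnected (b '' uIcc (proj b I x) (proj b I y)) :=
    isPreconnected_uIcc.image _ (hb.isGeodesicOn.mono hsub).continuousOn
  refine ⟨S ∪ b '' uIcc (proj b I x) (proj b I y) ∪ T, ?_, Or.inl (Or.inl hS.left_mem),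
    Or.inr hT.left_mem, ?_⟩
  · rintro w ((hw | ⟨t, ht, rfl⟩) | hw)
    · rwa [mem_preimage, (hX.projectsTo_iff hb).1 (hπx.of_mem_segment hS hw)]
    · rw [mem_preimage, (hX.projectsTo_iff hb).1 (projectsTo_self (hsub ht))]
      exact hJ.uIcc_subset hx hy ht
    · rwa [mem_preimage, (hX.projectsTo_iff hb).1 (hπy.of_mem_segment hT hw)]
  · have hunion := hS.isPreconnected.union (b (proj b I x)) hS.right_mem
      (mem_image_of_mem b left_mem_uIcc) hpath
    exact hunion.union (b (proj b I y)) (Or.inr (mem_image_of_mem b right_mem_uIcc)) hT.right_mem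
      hT.isPreconnected

/-! ### Perpendiculars to a geodesic -/

lemma projectsTo_zero_of_perpendicular (hI : I.OrdConnected) (hb : IsGeodesicOn b I) (hL : 0 ≤ L)
    (hc : IsGeodesicOn c (Icc 0 L)) (h0 : c 0 = b s) (hs : ProjectsTo b I (c L) s) (ht : t ∈ I) :
    ProjectsTo c (Icc 0 L) (b t) 0 := by
  refine ⟨left_mem_Icc.2 hL, fun r hr => ?_⟩
  have hsegment : IsGeodesicSegment (c '' Icc 0 L) (c L) (b s) :=
    h0 ▸ (hc.isGeodesicSegment_image hL).symm
  have hcr : ProjectsTo b I (c r) s := hs.of_mem_segment hsegment (mem_image_of_mem c hr)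
  have hle := hX.sq_dist_add_sq_le hI hb hcr ht
  rw [h0, hb t ht s hs.1, abs_sub_comm, dist_comm]
  exact abs_le_of_sq_le_sq (by linarith [sq_nonneg (dist (c r) (b s))]) dist_nonneg

lemma projectsTo_right_or_of_dist_add_dist (hL : 0 ≤ L) (hc : IsGeodesicOn c (Icc 0 L))
    (hxy : dist x (c L) + dist (c L) y = dist x y) :
    ProjectsTo c (Icc 0 L) x L ∨ ProjectsTo c (Icc 0 L) y L := by
  have hLmem : L ∈ Icc 0 L := right_mem_Icc.2 hL
  simp only [ProjectsTo, hLmem, true_and]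
  by_contra! hcon
  obtain ⟨⟨t, ht, hxt⟩, t', ht', hyt'⟩ := hcon
  wlog htt' : t ≤ t' generalizing x y t t'
  · exact this (by rw [dist_comm y, dist_comm _ x, dist_comm y x, add_comm, hxy]) t' ht' hyt' t ht
      hxt (le_of_not_ge htt')
  -- Both distances decrease when moving back from `c L` to `c t'`: a shortcut from `x` to `y`.
  have hxt' : dist x (c t') < dist x (c L) := by
    by_contra! hle
    have ht'L : t' < L := ht'.2.lt_of_ne fun h => by subst h; exact hyt'.false
    have htt'' : t < t' := htt'.lt_of_ne fun h => by subst h; exact (hxt.trans_le hle).false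
    have hconvex := (hX.strongConvexOn_sq_dist ordConnected_Icc hc x).convexOn fun r => by
      simpa using sq_nonneg r
    have hlt := hconvex.lt_right_of_left_lt ht hLmem
      (by rw [openSegment_eq_Ioo (htt''.trans ht'L)]; exact ⟨htt'', ht'L⟩)
      (pow_lt_pow_left₀ (hxt.trans_le hle) dist_nonneg two_ne_zero)
    exact hlt.not_ge (pow_le_pow_left₀ dist_nonneg hle 2)
  rw [dist_comm (c L) y] at hxy
  linarith [dist_triangle_right x y (c t')]

lemma exists_projectsTo_of_perpendicular (hb : IsClosedGeodesic b I) (hL : 0 ≤ L)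
    (hc : IsGeodesicOn c (Icc 0 L)) (h0 : c 0 = b s) (hs : ProjectsTo b I (c L) s)
    (hx : ProjectsTo b I x t) (hxc : ProjectsTo c (Icc 0 L) x L) {ρ κ : ℝ} (hρ : ρ ∈ uIcc s t)
    (hκ : κ ∈ Icc 0 L) : ∃ y, ProjectsTo b I y ρ ∧ ProjectsTo c (Icc 0 L) y κ := by
  have hc' := hc.isClosedGeodesic_Icc hL
  obtain ⟨S, hS⟩ := hX.exists_segment (c L) x
  obtain ⟨w, hwS, hw⟩ := hS.exists_apply_eq (hX.lipschitzWith_proj hb).continuous (r := ρ)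
    (by rwa [(hX.projectsTo_iff hb).1 hs, (hX.projectsTo_iff hb).1 hx])
  rw [← hX.projectsTo_iff hb] at hw
  have hwL : ProjectsTo c (Icc 0 L) w L := hxc.of_mem_segment hS.symm hwS
  have hfoot : ProjectsTo c (Icc 0 L) (b ρ) 0 :=
    hX.projectsTo_zero_of_perpendicular hb.ordConnected hb.isGeodesicOn hL hc h0 hs hw.1
  obtain ⟨T, hT⟩ := hX.exists_segment w (b ρ)
  obtain ⟨y, hyT, hy⟩ := hT.exists_apply_eq (hX.lipschitzWith_proj hc').continuous (r := κ)
    (by rwa [(hX.projectsTo_iff hc').1 hwL, (hX.projectsTo_iff hc').1 hfoot, uIcc_of_ge hL])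
  exact ⟨y, hw.of_mem_segment hT hyT, (hX.projectsTo_iff hc').2 hy⟩

end IsCAT0

/-! ### Heights over a curtain -/

namespace Curtain

/-- The signed distance along `h.b` from the centre of the pole to the projection of `x`. -/
noncomputable def height (h : Curtain X) (x : X) : ℝ :=
  proj h.b h.I x - h.r

/-- `g` describes the curtain `h` up to the orientation of its geodesic: `h.height` and
`-h.height` are the intended examples. -/
structure IsHeight (h : Curtain X) (g : X → ℝ) : Prop where
  lipschitzWith : LipschitzWith 1 g
  mem_carrier_iff : ∀ x, x ∈ h.carrier ↔ |g x| ≤ 1 / 2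
  isPreconnected : IsPreconnected {x | g x ≤ 1 / 2}

lemma centre_mem (h : Curtain X) : h.r ∈ h.I :=
  interior_subset (h.pole_subset ⟨by linarith, by linarith⟩)

lemma isClosedGeodesic (h : Curtain X) : IsClosedGeodesic h.b h.I :=
  ⟨h.isClosed_I, h.ordConnected_I, ⟨h.r, h.centre_mem⟩, h.isGeodesicOn⟩

lemma mem_carrier_of_projectsTo_centre (h : Curtain X) {x : X} (hx : ProjectsTo h.b h.I x h.r) :
    x ∈ h.carrier :=
  ⟨h.r, ⟨by linarith, by linarith⟩, hx⟩

lemma nonempty_carrier (h : Curtain X) : h.carrier.Nonempty :=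
  ⟨h.b h.r, h.mem_carrier_of_projectsTo_centre (projectsTo_self h.centre_mem)⟩

lemma IsHeight.lt_neg_half_of_le_half {h k : Curtain X} {g f : X → ℝ} (hg : h.IsHeight g)
    (hf : k.IsHeight f) (hneg : ∀ x ∈ h.carrier, f x < -(1 / 2))
    (hpos : ∀ x ∈ k.carrier, 1 / 2 < g x) {z : X} (hz : g z ≤ 1 / 2) : f z < -(1 / 2) := by
  by_contra! hge
  obtain ⟨w, hw⟩ := h.nonempty_carrier
  have hgw : g w ≤ 1 / 2 := (abs_le.1 ((hg.mem_carrier_iff w).1 hw)).2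
  obtain ⟨v, hv, hfv⟩ := hg.isPreconnected.intermediate_value hgw hz
    hf.lipschitzWith.continuous.continuousOn ⟨(hneg w hw).le, hge⟩
  have hvk : v ∈ k.carrier := (hf.mem_carrier_iff v).2 (by rw [hfv]; norm_num)
  exact (hpos v hvk).not_ge hv

end Curtain

namespace IsCAT0

variable (hX : IsCAT0 X)
include hX

lemma mem_carrier_iff (h : Curtain X) {x : X} : x ∈ h.carrier ↔ |h.height x| ≤ 1 / 2 := by
  rw [Curtain.height, abs_sub_comm, mem_Icc_iff_abs_le]
  exact hX.exists_projectsTo_iff h.isClosedGeodesic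

lemma mem_neg_iff (h : Curtain X) {x : X} : x ∈ h.neg ↔ h.height x < -(1 / 2) := by
  rw [Curtain.height, sub_lt_iff_lt_add', ← sub_eq_add_neg]
  exact hX.exists_projectsTo_iff h.isClosedGeodesic

lemma mem_pos_iff (h : Curtain X) {x : X} : x ∈ h.pos ↔ 1 / 2 < h.height x := by
  rw [Curtain.height, lt_sub_iff_add_lt']
  exact hX.exists_projectsTo_iff h.isClosedGeodesic

lemma isHeight_height (h : Curtain X) : h.IsHeight h.height where
  lipschitzWith := LipschitzWith.mk_one fun x y => by
    simpa [Curtain.height] using (hX.lipschitzWith_proj h.isClosedGeodesic).dist_le_mul x y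
  mem_carrier_iff _ := hX.mem_carrier_iff h
  isPreconnected := by
    simp only [Curtain.height, sub_le_iff_le_add]
    exact hX.isPreconnected_preimage_proj h.isClosedGeodesic ordConnected_Iic

lemma isHeight_neg_height (h : Curtain X) : h.IsHeight (-h.height) where
  lipschitzWith := (hX.isHeight_height h).lipschitzWith.neg
  mem_carrier_iff x := by rw [Pi.neg_apply, abs_neg, hX.mem_carrier_iff h]
  isPreconnected := by
    have hset : {x | (-h.height) x ≤ 1 / 2} = proj h.b h.I ⁻¹' Ici (h.r - 1 / 2) := by
      ext x
      simp only [Curtain.height, mem_ofPred_eq, Pi.neg_apply, neg_sub, mem_preimage, mem_Ici]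
      exact sub_le_comm
    rw [hset]
    exact hX.isPreconnected_preimage_proj h.isClosedGeodesic ordConnected_Ici

lemma exists_isHeight_of_separates {h : Curtain X} {A B : Set X} (hAB : h.Separates A B) :
    ∃ g, h.IsHeight g ∧ (∀ x ∈ A, g x < -(1 / 2)) ∧ ∀ x ∈ B, 1 / 2 < g x := by
  rcases hAB with ⟨hA, hB⟩ | ⟨hA, hB⟩
  · exact ⟨h.height, hX.isHeight_height h, fun x hx => (hX.mem_neg_iff h).1 (hA hx),
      fun x hx => (hX.mem_pos_iff h).1 (hB hx)⟩
  · exact ⟨-h.height, hX.isHeight_neg_height h,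
      fun x hx => neg_lt_neg ((hX.mem_pos_iff h).1 (hA hx)),
      fun x hx => lt_neg_of_lt_neg ((hX.mem_neg_iff h).1 (hB hx))⟩

end IsCAT0

/-! ### Thin grids imply slim triangles -/

namespace IsCAT0

variable (hX : IsCAT0 X) {b c : ℝ → X} {I : Set ℝ} {L s t : ℝ} {x y : X}
include hX

lemma isChain_of_add_one_lt {n : ℕ} {H : Fin n → Curtain X} (hb : ∀ i, (H i).b = b)
    (hI : ∀ i, (H i).I = I) (hr : ∀ i j, i < j → (H i).r + 1 < (H j).r) : IsChain H := by
  have hmem : ∀ i x, x ∈ (H i).carrier ↔ |proj b I x - (H i).r| ≤ 1 / 2 := fun i x => by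
    rw [hX.mem_carrier_iff, Curtain.height, hb, hI]
  constructor
  · intro i j hij
    rw [disjoint_left]
    intro x hxi hxj
    rw [hmem, abs_le] at hxi hxj
    rcases hij.lt_or_gt with hlt | hlt <;> linarith [hr _ _ hlt]
  · refine fun i j k hij hjk => Or.inl ⟨fun x hx => ?_, fun x hx => ?_⟩
    · rw [hmem, abs_le] at hx
      rw [hX.mem_neg_iff, Curtain.height, hb, hI]
      linarith [hr i j (Fin.lt_def.2 (by omega))]
    · rw [hmem, abs_le] at hx
      rw [hX.mem_pos_iff, Curtain.height, hb, hI]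
      linarith [hr j k (Fin.lt_def.2 (by omega))]

lemma exists_isChain_of_le_abs_sub (hb : IsClosedGeodesic b I) (hs : s ∈ I) (ht : t ∈ I) {N : ℕ}
    (hst : 2 * (N : ℝ) ≤ |s - t|) : ∃ H : Fin N → Curtain X, IsChain H ∧
      ∀ i, (H i).b = b ∧ (H i).I = I ∧ (H i).r ∈ uIcc s t := by
  wlog hle : s ≤ t generalizing s t
  · rw [uIcc_comm]
    exact this ht hs (by rwa [abs_sub_comm]) (le_of_not_ge hle)
  rw [uIcc_of_le hle]
  rw [abs_sub_comm, abs_of_nonneg (sub_nonneg.2 hle)] at hst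
  have hpole : ∀ i : Fin N, Icc (s + 1 + 2 * (i : ℕ) - 1 / 2) (s + 1 + 2 * (i : ℕ) + 1 / 2) ⊆
      Ioo s t := fun i => by
    have hi : ((i : ℕ) : ℝ) + 1 ≤ N := by exact_mod_cast i.2
    exact Icc_subset_Ioo (by linarith [Nat.cast_nonneg (α := ℝ) (i : ℕ)]) (by linarith)
  let H : Fin N → Curtain X := fun i =>
    { b := b
      I := I
      r := s + 1 + 2 * (i : ℕ)
      isClosed_I := hb.isClosed
      ordConnected_I := hb.ordConnected
      isGeodesicOn := hb.isGeodesicOn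
      pole_subset := (hpole i).trans
        (interior_Icc.symm.subset.trans (interior_mono (hb.ordConnected.out hs ht))) }
  refine ⟨H, hX.isChain_of_add_one_lt (fun _ => rfl) (fun _ => rfl) fun i j hij => ?_,
    fun i => ⟨rfl, rfl, Ioo_subset_Icc_self (hpole i ⟨by linarith, by linarith⟩)⟩⟩
  have hij' : ((i : ℕ) : ℝ) + 1 ≤ (j : ℕ) := by exact_mod_cast hij
  simp only [H]
  linarith

lemma exists_isCurtainGrid_of_perpendicular (hb : IsClosedGeodesic b I)
    (hc : IsGeodesicOn c (Icc 0 L)) (h0 : c 0 = b s) (hs : ProjectsTo b I (c L) s)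
    (hx : ProjectsTo b I x t) (hxc : ProjectsTo c (Icc 0 L) x L) {N : ℕ} (hL : 2 * (N : ℝ) ≤ L)
    (hst : 2 * (N : ℝ) ≤ |s - t|) : ∃ H K : Fin N → Curtain X, IsCurtainGrid H K := by
  have hL0 : 0 ≤ L := le_trans (by positivity) hL
  obtain ⟨H, hH, hHb⟩ := hX.exists_isChain_of_le_abs_sub hb hs.1 hx.1 hst
  obtain ⟨K, hK, hKc⟩ := hX.exists_isChain_of_le_abs_sub (hc.isClosedGeodesic_Icc hL0)
    (left_mem_Icc.2 hL0) (right_mem_Icc.2 hL0) (by rwa [zero_sub, abs_neg, abs_of_nonneg hL0])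
  refine ⟨H, K, hH, hK, fun i j => ?_⟩
  obtain ⟨hbi, hIi, hri⟩ := hHb i
  obtain ⟨hcj, hIj, hrj⟩ := hKc j
  rw [uIcc_of_le hL0] at hrj
  obtain ⟨y, hyH, hyK⟩ :=
    hX.exists_projectsTo_of_perpendicular hb hL0 hc h0 hs hx hxc hri hrj
  exact ⟨y, (H i).mem_carrier_of_projectsTo_centre (by rwa [hbi, hIi]),
    (K j).mem_carrier_of_projectsTo_centre (by rwa [hcj, hIj])⟩

lemma dist_proj_lt_of_not_isCurtainGrid {N : ℕ}
    (hN : ∀ H K : Fin N → Curtain X, ¬ IsCurtainGrid H K) (hb : IsClosedGeodesic b I) {S : Set X}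
    (hS : IsGeodesicSegment S x y) {p : X} (hp : p ∈ S)
    (hpx : 2 * (N : ℝ) ≤ |proj b I p - proj b I x|)
    (hpy : 2 * (N : ℝ) ≤ |proj b I p - proj b I y|) : dist p (b (proj b I p)) < 2 * N := by
  by_contra! hfar
  rw [dist_comm] at hfar
  have hπp := hb.projectsTo_proj p
  obtain ⟨-, c, hc, h0, h1, -⟩ := hX.exists_segment (b (proj b I p)) p
  have hgrid : ∀ z, 2 * (N : ℝ) ≤ |proj b I p - proj b I z| →
      ¬ ProjectsTo c (Icc 0 (dist (b (proj b I p)) p)) z (dist (b (proj b I p)) p) :=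
    fun z hz hzc => by
      obtain ⟨H, K, hHK⟩ := hX.exists_isCurtainGrid_of_perpendicular hb hc h0 (h1.symm ▸ hπp)
        (hb.projectsTo_proj z) hzc hfar hz
      exact hN H K hHK
  rcases hX.projectsTo_right_or_of_dist_add_dist dist_nonneg hc
    (by rw [h1]; exact hS.dist_add_dist hp) with hx | hy
  · exact hgrid x hpx hx
  · exact hgrid y hpy hy

end IsCAT0

lemma exists_mem_uIcc_abs_sub_eq {s t₀ t₁ d : ℝ} (hs : s ∈ uIcc t₀ t₁) (hd : 0 ≤ d)
    (hsd : 2 * d ≤ |s - t₀|) :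
    ∃ t ∈ uIcc t₀ t₁, |s - t| = d ∧ d ≤ |t - t₀| ∧ d ≤ |t - t₁| := by
  rcases mem_uIcc.1 hs with ⟨h0, h1⟩ | ⟨h1, h0⟩
  · rw [abs_of_nonneg (sub_nonneg.2 h0)] at hsd
    exact ⟨s - d, mem_uIcc.2 (Or.inl ⟨by linarith, by linarith⟩),
      by rw [sub_sub_cancel, abs_of_nonneg hd], le_abs.2 (Or.inl (by linarith)),
      le_abs.2 (Or.inr (by linarith))⟩
  · rw [abs_sub_comm, abs_of_nonneg (sub_nonneg.2 h0)] at hsd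
    exact ⟨s + d, mem_uIcc.2 (Or.inr ⟨by linarith, by linarith⟩),
      by rw [sub_add_cancel_left, abs_neg, abs_of_nonneg hd], le_abs.2 (Or.inr (by linarith)),
      le_abs.2 (Or.inl (by linarith))⟩

/-- The geodesic triangles of `X` are `δ`-slim. -/
def IsSlim (X : Type*) [MetricSpace X] (δ : ℝ) : Prop :=
  ∀ (x y z : X) (Sxy Syz Sxz : Set X),
    IsGeodesicSegment Sxy x y → IsGeodesicSegment Syz y z → IsGeodesicSegment Sxz x z →
    ∀ p ∈ Sxy, ∃ q ∈ Syz ∪ Sxz, dist p q ≤ δ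

namespace IsCAT0

variable (hX : IsCAT0 X) {b : ℝ → X} {I : Set ℝ} {s t : ℝ}
include hX

lemma exists_mem_dist_le_of_not_isCurtainGrid {N : ℕ}
    (hN : ∀ H K : Fin N → Curtain X, ¬ IsCurtainGrid H K) (hb : IsClosedGeodesic b I) {S : Set X}
    {z : X} (ht : t ∈ I) (hS : IsGeodesicSegment S (b t) z) (hs : s ∈ uIcc t (proj b I z)) :
    ∃ q ∈ S, dist (b s) q ≤ 4 * N := by
  have hπt : proj b I (b t) = t := (hX.projectsTo_iff hb).1 (projectsTo_self ht)
  have hsI : s ∈ I := hb.ordConnected.uIcc_subset ht (hb.projectsTo_proj z).1 hs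
  rcases le_total (|s - t|) (4 * N) with hnear | hfar
  · exact ⟨b t, hS.left_mem, by rwa [hb.isGeodesicOn s hsI t ht]⟩
  obtain ⟨u, hu, hsu, hut, huz⟩ := exists_mem_uIcc_abs_sub_eq hs (d := 2 * N) (by positivity)
    (by linarith)
  obtain ⟨q, hq, rfl⟩ := hS.exists_apply_eq (hX.lipschitzWith_proj hb).continuous (by rwa [hπt])
  have hclose := hX.dist_proj_lt_of_not_isCurtainGrid hN hb hS hq (by rwa [hπt]) huz
  rw [← hb.isGeodesicOn s hsI _ (hb.projectsTo_proj q).1] at hsu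
  exact ⟨q, hq, by linarith [dist_triangle_right (b s) q (b (proj b I q))]⟩

theorem isSlim_of_not_isCurtainGrid {N : ℕ}
    (hN : ∀ H K : Fin N → Curtain X, ¬ IsCurtainGrid H K) : IsSlim X (4 * N) := by
  rintro x y z - Syz Sxz ⟨b, hb, h0, h1, rfl⟩ hyz hxz - ⟨s, hs, rfl⟩
  have hb' := hb.isClosedGeodesic_Icc dist_nonneg
  rcases le_total s (proj b (Icc 0 (dist x y)) z) with hsz | hsz
  · obtain ⟨q, hq, hsq⟩ := hX.exists_mem_dist_le_of_not_isCurtainGrid hN hb'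
      (left_mem_Icc.2 dist_nonneg) (h0.symm ▸ hxz) (mem_uIcc_of_le hs.1 hsz)
    exact ⟨q, Or.inr hq, hsq⟩
  · obtain ⟨q, hq, hsq⟩ := hX.exists_mem_dist_le_of_not_isCurtainGrid hN hb'
      (right_mem_Icc.2 dist_nonneg) (h1.symm ▸ hyz) (mem_uIcc_of_ge hsz hs.2)
    exact ⟨q, Or.inl hq, hsq⟩

theorem isGromovHyperbolic_of_allGridsThin {E : ℝ} (hE : AllGridsThin X E) :
    IsGromovHyperbolic X := by
  obtain ⟨N, hN⟩ := exists_nat_gt E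
  exact ⟨4 * N, by positivity, hX.isSlim_of_not_isCurtainGrid fun H K hHK =>
    hN.not_ge (by simpa only [min_self] using hE N N H K hHK)⟩

end IsCAT0

/-! ### Slim triangles imply thin grids -/

lemma IsGeodesicSpace.add_one_le_dist_of_nested (hX : IsGeodesicSpace X) {n : ℕ}
    {g : Fin (n + 1) → X → ℝ} (hg : ∀ i, LipschitzWith 1 (g i))
    (hnested : ∀ (i : Fin n) z, g i.castSucc z ≤ 1 / 2 → g i.succ z < -(1 / 2)) {x : X}
    (hx : g 0 x < -(1 / 2)) (i : Fin (n + 1)) {y : X} (hy : 1 / 2 < g i y) :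
    ((i : ℕ) : ℝ) + 1 ≤ dist x y := by
  have hgap : ∀ i {w z : X}, g i w = -(1 / 2) → 1 / 2 < g i z → 1 ≤ dist w z :=
    fun i w z hw hz => by
      have hle := (hg i).le_add_mul z w
      rw [NNReal.coe_one, one_mul, dist_comm] at hle
      linarith
  have hneg : ∀ i, g i x < -(1 / 2) := by
    intro i
    induction i using Fin.induction with
    | zero => exact hx
    | succ i ih => exact hnested i x (by linarith)
  have henter : ∀ i {z : X}, 1 / 2 < g i z →
      ∃ w, g i w = -(1 / 2) ∧ dist x w + dist w z = dist x z := fun i z hz => by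
    obtain ⟨S, hS⟩ := hX x z
    obtain ⟨w, hwS, hw⟩ := hS.exists_apply_eq (hg i).continuous
      (mem_uIcc_of_le (hneg i).le (by linarith))
    exact ⟨w, hw, hS.dist_add_dist hwS⟩
  induction i using Fin.induction generalizing y with
  | zero =>
    obtain ⟨w, hw, hxwy⟩ := henter 0 hy
    simpa using (hgap 0 hw hy).trans (by linarith [dist_nonneg (x := x) (y := w)])
  | succ i ih =>
    obtain ⟨w, hw, hxwy⟩ := henter i.succ hy
    have hxw := ih (not_le.1 fun hle => (hnested i w hle).ne hw)
    simp only [Fin.val_castSucc, Fin.val_succ, Nat.cast_add, Nat.cast_one] at hxw ⊢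
    linarith [hgap i.succ hw hy]

lemma IsCAT0.natCast_le_dist_of_isChain (hX : IsCAT0 X) {n : ℕ} {h : Fin (n + 2) → Curtain X}
    (hh : IsChain h) {x y : X} (hx : x ∈ (h 0).carrier) (hy : y ∈ (h (Fin.last _)).carrier) :
    (n : ℝ) ≤ dist x y := by
  rcases n with _ | n
  · simp
  have hsep : ∀ i : Fin (n + 1), ∃ g, (h i.castSucc.succ).IsHeight g ∧
      (∀ x ∈ (h i.castSucc.castSucc).carrier, g x < -(1 / 2)) ∧
      ∀ x ∈ (h i.succ.succ).carrier, 1 / 2 < g x := fun i =>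
    hX.exists_isHeight_of_separates (hh.2 _ _ _ (by simp) (by simp))
  choose g hg hneg hpos using hsep
  have hnested : ∀ (i : Fin n) z, g i.castSucc z ≤ 1 / 2 → g i.succ z < -(1 / 2) := fun i z =>
    (hg i.castSucc).lt_neg_half_of_le_half (hg i.succ) (hneg i.succ) (hpos i.castSucc)
  simpa using hX.isGeodesicSpace.add_one_le_dist_of_nested (fun i => (hg i).lipschitzWith) hnested
    (hneg 0 x hx) (Fin.last n) (hpos (Fin.last n) y hy)

/-- `ε`-quasiconvexity: geodesic segments between points of `A` stay `ε`-close to `A`. -/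
def IsQuasiconvex (ε : ℝ) (A : Set X) : Prop :=
  ∀ x ∈ A, ∀ y ∈ A, ∀ S, IsGeodesicSegment S x y → ∀ p ∈ S, ∃ q ∈ A, dist p q ≤ ε

namespace IsSlim

variable {δ : ℝ} (hδ : IsSlim X δ) (hX : IsGeodesicSpace X)
include hδ hX

lemma isQuasiconvex_carrier (h : Curtain X) : IsQuasiconvex (2 * δ) h.carrier := by
  rintro x ⟨s, hs, hxs⟩ y ⟨t, ht, hyt⟩ S hS p hp
  wlog hst : s ≤ t generalizing x y s t
  · exact this y t ht hyt x s hs hxs hS.symm (le_of_not_ge hst)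
  obtain ⟨A, hA⟩ := hX x (h.b s)
  obtain ⟨B, hB⟩ := hX y (h.b t)
  obtain ⟨D, hD⟩ := hX y (h.b s)
  have hsub : Icc s t ⊆ h.I := h.ordConnected_I.out hxs.1 hyt.1
  have hbase := (h.isGeodesicOn.mono hsub).isGeodesicSegment_image hst
  have hAh : A ⊆ h.carrier := fun q hq => ⟨s, hs, hxs.of_mem_segment hA hq⟩
  have hBh : B ⊆ h.carrier := fun q hq => ⟨t, ht, hyt.of_mem_segment hB hq⟩
  have hbaseh : h.b '' Icc s t ⊆ h.carrier := by
    rintro _ ⟨r, hr, rfl⟩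
    exact ⟨r, ⟨hs.1.trans hr.1, hr.2.trans ht.2⟩, projectsTo_self (hsub hr)⟩
  obtain ⟨q, hq, hpq⟩ := hδ x y (h.b s) S D A hS hD hA p hp
  have hδ0 : 0 ≤ δ := dist_nonneg.trans hpq
  rcases hq with hq | hq
  · obtain ⟨w, hw, hqw⟩ := hδ y (h.b s) (h.b t) D _ B hD hbase hB q hq
    exact ⟨w, union_subset hbaseh hBh hw, by linarith [dist_triangle p q w]⟩
  · exact ⟨q, hAh hq, by linarith⟩

lemma exists_dist_le_or_of_isQuasiconvex {ε : ℝ} {A B S : Set X} (hA : IsQuasiconvex ε A)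
    (hB : IsQuasiconvex ε B) {x y z p : X} (hx : x ∈ A) (hy : y ∈ A ∩ B) (hz : z ∈ B)
    (hS : IsGeodesicSegment S x z) (hp : p ∈ S) :
    (∃ q ∈ A, dist p q ≤ δ + ε) ∨ ∃ q ∈ B, dist p q ≤ δ + ε := by
  obtain ⟨T, hT⟩ := hX x y
  obtain ⟨U, hU⟩ := hX z y
  obtain ⟨w, hw | hw, hpw⟩ := hδ x z y S U T hS hU hT p hp
  · obtain ⟨q, hq, hwq⟩ := hB z hz y hy.2 U hU w hw
    exact Or.inr ⟨q, hq, by linarith [dist_triangle p w q]⟩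
  · obtain ⟨q, hq, hwq⟩ := hA x hx y hy.1 T hT w hw
    exact Or.inl ⟨q, hq, by linarith [dist_triangle p w q]⟩

lemma exists_dist_lt_of_quadrilateral {ε R : ℝ} {A A' B B' : Set X} (hA : IsQuasiconvex ε A)
    (hA' : IsQuasiconvex ε A') (hB : IsQuasiconvex ε B) (hB' : IsQuasiconvex ε B')
    (hAB : (A ∩ B).Nonempty) (hAB' : (A ∩ B').Nonempty) (hA'B : (A' ∩ B).Nonempty)
    (hA'B' : (A' ∩ B').Nonempty) (hR : 2 * (δ + ε) < R) :
    (∃ p ∈ A, ∃ q ∈ A', dist p q < R) ∨ ∃ p ∈ B, ∃ q ∈ B', dist p q < R := by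
  rw [or_iff_not_imp_right]
  intro hBfar
  obtain ⟨a, haA, haB⟩ := hAB
  obtain ⟨b, hb⟩ := hAB'
  obtain ⟨c, hcA', hcB'⟩ := hA'B'
  obtain ⟨d, hdA', hdB⟩ := hA'B
  obtain ⟨S, hS⟩ := hX a c
  have hcover : S ⊆ thickening (R / 2) A ∪ thickening (R / 2) A' := fun p hp => by
    simp only [mem_union, mem_thickening_iff]
    rcases hδ.exists_dist_le_or_of_isQuasiconvex hX hA hB' haA hb hcB' hS hp with
      ⟨q, hq, hpq⟩ | ⟨q', hq', hpq'⟩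
    · exact Or.inl ⟨q, hq, by linarith⟩
    rcases hδ.exists_dist_le_or_of_isQuasiconvex hX hB hA' haB ⟨hdB, hdA'⟩ hcA' hS hp with
      ⟨q, hq, hpq⟩ | ⟨q, hq, hpq⟩
    · exact absurd ⟨q, hq, q', hq', by linarith [dist_triangle_left q q' p]⟩ hBfar
    · exact Or.inr ⟨q, hq, by linarith⟩
  have hR0 : 0 < R / 2 := by
    by_contra! hle
    simpa only [thickening_of_nonpos hle, union_self, mem_empty_iff_false] using hcover hS.left_mem
  obtain ⟨p, hp, q, hq, hpq⟩ := exists_dist_lt_two_mul_of_subset_thickening_union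
    hS.isPreconnected hcover ⟨a, hS.left_mem, self_subset_thickening hR0 A haA⟩
    ⟨c, hS.right_mem, self_subset_thickening hR0 A' hcA'⟩
  exact ⟨p, hp, q, hq, by linarith⟩

end IsSlim

theorem IsCAT0.allGridsThin_of_isSlim (hX : IsCAT0 X) {δ : ℝ} (hδ0 : 0 ≤ δ) (hδ : IsSlim X δ) :
    AllGridsThin X (6 * δ + 3) := by
  rintro n m H K ⟨hH, hK, hHK⟩
  by_contra! hlt
  obtain ⟨hn, hm⟩ := lt_min_iff.1 hlt
  obtain ⟨n, rfl⟩ : ∃ k, n = k + 2 := Nat.exists_eq_add_of_le' (by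
    exact_mod_cast (show (2 : ℝ) ≤ n by linarith))
  obtain ⟨m, rfl⟩ : ∃ k, m = k + 2 := Nat.exists_eq_add_of_le' (by
    exact_mod_cast (show (2 : ℝ) ≤ m by linarith))
  push_cast at hn hm
  have hquasi := hδ.isQuasiconvex_carrier hX.isGeodesicSpace
  rcases hδ.exists_dist_lt_of_quadrilateral hX.isGeodesicSpace (R := 6 * δ + 1) (hquasi (H 0))
    (hquasi (H (Fin.last _))) (hquasi (K 0)) (hquasi (K (Fin.last _))) (hHK _ _) (hHK _ _)
    (hHK _ _) (hHK _ _) (by linarith) with ⟨p, hp, q, hq, hpq⟩ | ⟨p, hp, q, hq, hpq⟩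
  · linarith [hX.natCast_le_dist_of_isChain hH hp hq]
  · linarith [hX.natCast_le_dist_of_isChain hK hp hq]

end CurtainGrid

theorem theoremE {X : Type*} [MetricSpace X] (hX : CurtainGrid.IsCAT0 X) :
    CurtainGrid.IsGromovHyperbolic X ↔
      ∃ E : ℝ, 0 < E ∧ CurtainGrid.AllGridsThin X E := by
  constructor
  · rintro ⟨δ, hδ0, hδ⟩
    exact ⟨6 * δ + 3, by positivity, hX.allGridsThin_of_isSlim hδ0 hδ⟩
  · rintro ⟨E, -, hE⟩
    exact hX.isGromovHyperbolic_of_allGridsThin hE
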